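/- Let $a_1,\dots,a_N$ be complex $n\times n$ matrices obeying the canonical anticommutation relations $a_k^\dagger a_l+a_la_k^\dagger=\delta_{kl}\mathbb 1$, $a_ka_l+a_la_k=0$ (fermionic mode operators on a finite-dimensional Hilbert space), and let $c_{2j-1}=a_j^\dagger+a_j$, $c_{2j}=-i(a_j^\dagger-a_j)$ be the $2N$ Majorana operators. A state is a positive semidefinite matrix of trace $1$. Let $\mathcal V_G$ be the set of all states of the form $\kappa\exp[-\tfrac i2\sum_{k,l}K_{kl}c_kc_l]$ with $\kappa\in\mathbb R$ and $K=-K^T\in\mathbb R^{2N\times 2N}$ (the full-rank fermionic Gaussian states). For $\rho\in\mathcal V_G$ let $T_\rho\mathcal V_G$ be its tangent space, i.e. the real span of the velocities $\dot\gamma(0)$ of curves $\gamma$ in $\mathcal V_G$ that are differentiable at $0$ with $\gamma(0)=\rho$. The covariance matrix of a state $\sigma$ is $\Gamma(\sigma)_{kl}=\tfrac i2\operatorname{tr}([c_k,c_l]\sigma)$, and a Gaussification of $\sigma$ is a $\mathcal G(\sigma)\in\mathcal V_G$ with $\Gamma(\mathcal G(\sigma))=\Gamma(\sigma)$. Let $(\mathcal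 E_t)_{t\ge0}$ be a differentiable Markovian evolution: completely positive trace-preserving linear maps on the $n\times n$ matrices with $\mathcal E_0=\mathrm{id}$, $\mathcal E_{s+t}=\mathcal E_s\mathcal E_t$, and $\partial_t\rho_t=\mathcal L(\rho_t)$ for all $\rho_t=\mathcal E_t(\rho_0)$, where the generator $\mathcal L$ is linear. For $\rho\in\mathcal V_G$ and $\alpha\in\mathbb R$ put $$\Omega^\alpha_\rho(\sigma)=\tfrac12\left(\rho^{-\alpha}\sigma\rho^{\alpha-1}+\rho^{\alpha-1}\sigma\rho^{-\alpha}\right).$$ Then for every $\rho\in\mathcal V_G$ there is an $A\in T_\rho\mathcal V_G$ such that: 1. for every convex combination $\Omega$ of the superoperators $\Omega^\alpha_\rho$, $\alpha\in\mathbb R$, $A$ is the unique minimizer over $B\in T_\rho\mathcal V_G$ of $\operatorname{tr}[(B-\mathcal L(\rho))^\dagger\,\Omega(B-\mathcal L(\rho))]$ (so the locally optimal projection of $\mathcal L(\rho)$ onto $T_\rho\mathcal V_G$ is the same for all these metrics); 2. for every basis $(\partial_j\rho)_j$ of the real vector space $T_\rho\mathcal V_G$ one has $A=\sum_jv^j\partial_j\rho$,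 where $v$ is the unique real solution of $$\operatorname{tr}[c_{k_1}c_{k_2}\mathcal L(\rho)]=\sum_jv^j\operatorname{tr}[c_{k_1}c_{k_2}\partial_j\rho]\qquad\text{for all }k_1,k_2;$$ 3. $A$ is the velocity of the Gaussified evolution: for all sufficiently small $s\ge0$ the states $\mathcal E_s(\rho)$ and $\rho+s\mathcal L(\rho)$ have unique Gaussifications, and the curves $s\mapsto\mathcal G(\mathcal E_s(\rho))$ and $s\mapsto\mathcal G(\rho+s\mathcal L(\rho))$ both have right derivative $A$ at $s=0$. -/

import Mathlib

open scoped Topology ComplexOrder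

noncomputable section

namespace FermionTDVP

variable {N : ℕ} {n : Type*} [Fintype n] [DecidableEq n]

/-! ### States and Markovian evolutions -/

/-- Density matrices: positive semidefinite (hence Hermitian) of unit trace. -/
def IsState (ρ : Matrix n n ℂ) : Prop :=
  ρ.PosSemidef ∧ ρ.trace = 1

/-- The ampliation `id_m ⊗ Φ` of a superoperator `Φ`, acting on `m × m` block matrices with
blocks in `Matrix n n ℂ`. -/
def ampliation (m : ℕ) (Φ : Matrix n n ℂ →ₗ[ℂ] Matrix n n ℂ)
    (X : Matrix (Fin m × n) (Fin m × n) ℂ) : Matrix (Fin m × n) (Fin m × n) ℂ :=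
  Matrix.of fun p q => Φ (Matrix.of fun i j => X (p.1, i) (q.1, j)) p.2 q.2

/-- Completely positive trace-preserving maps. -/
def IsCPT (Φ : Matrix n n ℂ →ₗ[ℂ] Matrix n n ℂ) : Prop :=
  (∀ (m : ℕ) (X : Matrix (Fin m × n) (Fin m × n) ℂ),
      X.PosSemidef → (ampliation m Φ X).PosSemidef) ∧
    ∀ X : Matrix n n ℂ, (Φ X).trace = X.trace

/-- `E t`, `t ≥ 0`, is a differentiable Markovian (semigroup) evolution by CPT maps with
generator `L`: the curves `ρ_t = E t ρ₀` solve `∂ₜ ρ_t = L ρ_t`. -/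
structure IsMarkovianEvolution (E : ℝ → (Matrix n n ℂ →ₗ[ℂ] Matrix n n ℂ))
    (L : Matrix n n ℂ →ₗ[ℂ] Matrix n n ℂ) : Prop where
  cpt : ∀ t, 0 ≤ t → IsCPT (E t)
  zero : E 0 = LinearMap.id
  add : ∀ s t, 0 ≤ s → 0 ≤ t → E (s + t) = E s ∘ₗ E t
  deriv : ∀ (ρ₀ : Matrix n n ℂ) (t : ℝ), 0 ≤ t →
    HasDerivWithinAt (fun s => E s ρ₀) (L (E t ρ₀)) (Set.Ici 0) t

/-! ### Fermionic modes and Gaussian states -/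

/-- Canonical anticommutation relations for `N` fermionic mode operators. -/
structure IsCAR (a : Fin N → Matrix n n ℂ) : Prop where
  anticomm_star : ∀ k l, (a k).conjTranspose * a l + a l * (a k).conjTranspose
    = if k = l then 1 else 0
  anticomm : ∀ k l, a k * a l + a l * a k = 0

/-- The `2N` Majorana operators: `majorana a (j, 0) = a_j† + a_j` and
`majorana a (j, 1) = -i (a_j† - a_j)`. -/
def majorana (a : Fin N → Matrix n n ℂ) (k : Fin N × Fin 2) : Matrix n n ℂ :=
  if k.2 = 0 then (a k.1).conjTranspose + a k.1
  else (-Complex.I) • ((a k.1).conjTranspose - a k.1)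

/-- The quadratic expression `-(i/2) cᵀ K c`. -/
def quadraticForm (a : Fin N → Matrix n n ℂ) (K : Matrix (Fin N × Fin 2) (Fin N × Fin 2) ℝ) :
    Matrix n n ℂ :=
  (-(Complex.I / 2)) • ∑ k, ∑ l, (K k l : ℂ) • (majorana a k * majorana a l)

/-- The set `V_G` of full-rank fermionic Gaussian states: the density matrices of the form
`κ exp(-(i/2) cᵀ K c)` with `K` real and antisymmetric. -/
def gaussianStates (a : Fin N → Matrix n n ℂ) : Set (Matrix n n ℂ) :=
  {ρ | IsState ρ ∧ ∃ (κ : ℝ) (K : Matrix (Fin N × Fin 2) (Fin N × Fin 2) ℝ),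
    K.transpose = -K ∧ ρ = (κ : ℂ) • NormedSpace.exp (quadraticForm a K)}

/-- The covariance matrix `Γ_{kl} = (i/2) tr([c_k, c_l] ρ)`. -/
def covariance (a : Fin N → Matrix n n ℂ) (ρ : Matrix n n ℂ) :
    Matrix (Fin N × Fin 2) (Fin N × Fin 2) ℂ :=
  Matrix.of fun k l => (Complex.I / 2) *
    ((majorana a k * majorana a l - majorana a l * majorana a k) * ρ).trace

/-- `ρG` is a Gaussification of the state `σ`: the Gaussian state with the same covariance
matrix. -/
def IsGaussification (a : Fin N → Matrix n n ℂ) (σ ρG : Matrix n n ℂ) : Prop :=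
  IsState σ ∧ ρG ∈ gaussianStates a ∧ covariance a ρG = covariance a σ

/-- `A` is the velocity at time `0` of the Gaussified curve `s ↦ 𝒢(σ s)`, `s ≥ 0`: for all small
`s ≥ 0` the Gaussification of `σ s` exists and is unique, and the resulting curve has right
derivative `A` at `0`. -/
def IsGaussifiedVelocity (a : Fin N → Matrix n n ℂ) (σ : ℝ → Matrix n n ℂ)
    (A : Matrix n n ℂ) : Prop :=
  (∀ᶠ s in 𝓝[≥] (0 : ℝ), ∃! ρG, IsGaussification a (σ s) ρG) ∧
    ∀ γ : ℝ → Matrix n n ℂ, (∀ᶠ s in 𝓝[≥] (0 : ℝ), IsGaussification a (σ s) (γ s)) →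
      HasDerivWithinAt γ A (Set.Ici 0) 0

/-! ### Tangent spaces, metrics and the variational principle -/

/-- The (real) tangent space at `ρ` of a set `V` of matrices: the span of the velocities at `ρ`
of the curves in `V` through `ρ`. -/
def tangentSpace (V : Set (Matrix n n ℂ)) (ρ : Matrix n n ℂ) : Submodule ℝ (Matrix n n ℂ) :=
  Submodule.span ℝ {A | ∃ γ : ℝ → Matrix n n ℂ, (∀ s, γ s ∈ V) ∧ γ 0 = ρ ∧ HasDerivAt γ A 0}

/-- The real power `ρ ^ α` of a positive definite matrix, by functional calculus. -/
def matPow (ρ : Matrix n n ℂ) (α : ℝ) : Matrix n n ℂ :=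
  cfc (fun x : ℝ => x ^ α) ρ

/-- The superoperator `Ω_ρ^α(σ) = ½ (ρ^{-α} σ ρ^{α-1} + ρ^{α-1} σ ρ^{-α})`. -/
def alphaMetric (ρ : Matrix n n ℂ) (α : ℝ) : Matrix n n ℂ →ₗ[ℂ] Matrix n n ℂ :=
  (1 / 2 : ℂ) • (LinearMap.mulLeftRight ℂ (matPow ρ (-α), matPow ρ (α - 1)) +
    LinearMap.mulLeftRight ℂ (matPow ρ (α - 1), matPow ρ (-α)))

/-- The superoperators of `α`-norm type at `ρ` and all their convex combinations. -/
def alphaMetrics (ρ : Matrix n n ℂ) : Set (Matrix n n ℂ →ₗ[ℂ] Matrix n n ℂ) :=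
  convexHull ℝ (Set.range (alphaMetric ρ))

/-- The squared length `⟨A, Ω(A)⟩ = tr(A† Ω(A))`. The value is real for the superoperators of
`alphaMetrics`; the real part only changes its type. -/
def sqLength (Ω : Matrix n n ℂ →ₗ[ℂ] Matrix n n ℂ) (A : Matrix n n ℂ) : ℝ :=
  (A.conjTranspose * Ω A).trace.re

/-- `A` is an element of `T` closest to `X` in the metric given by `Ω`. -/
def IsTDVPProjection (Ω : Matrix n n ℂ →ₗ[ℂ] Matrix n n ℂ) (T : Submodule ℝ (Matrix n n ℂ))
    (X A : Matrix n n ℂ) : Prop :=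
  A ∈ T ∧ ∀ B ∈ T, sqLength Ω (A - X) ≤ sqLength Ω (B - X)

end FermionTDVP

end

/-!
The Gaussian states are the exponentials of trace one in a real space `R` of Hermitian matrices
spanned by `1` and the quadratic forms in the Majorana operators. The moment map
`A ↦ (Z ↦ Re tr (Z A))`, `Z ∈ R`, carries the same information as the trace and the covariance
matrix. By Duhamel's formula and the faithfulness of the trace, `Re tr (Y (D exp(H) Y)) > 0` for
`0 ≠ Y ∈ R`: the moment map is injective on the Gaussian states and, by the inverse function
theorem, locally invertible. So Gaussification means matching moments, and the velocity of a
Gaussified curve is the tangent vector `A` with the same moments as the velocity `X` of the curve.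

By the anticommutation relations the complex span of `1` and the products `c_k c_l` is closed under
commutators, hence under `exp(H) Y exp(-H)`. Therefore every metric `Ω` in question maps tangent
vectors `C` at `exp(H)` into this span, on which `A` and `X` have the same moments:
`tr ((A - X)† Ω(C)) = 0` for all of these metrics at once.
-/

namespace FermionTDVP

section Exponential

open NormedSpace

variable {𝔸 : Type*} [NormedRing 𝔸] [NormedAlgebra ℝ 𝔸] [CompleteSpace 𝔸]

@[fun_prop]
theorem continuous_exp : Continuous (exp : 𝔸 → 𝔸) :=
  continuous_iff_continuousAt.2 fun x => (exp_analytic (𝕂 := ℝ) x).continuousAt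

theorem hasStrictFDerivAt_exp (H : 𝔸) : HasStrictFDerivAt (exp : 𝔸 → 𝔸) (fderiv ℝ exp H) H :=
  (exp_analytic (𝕂 := ℝ) H).hasStrictFDerivAt

theorem exp_smul_mul_exp_smul (H : 𝔸) (s t : ℝ) :
    exp (s • H) * exp (t • H) = exp ((s + t) • H) := by
  let _ : NormedAlgebra ℚ 𝔸 := NormedAlgebra.restrictScalars ℚ ℝ 𝔸
  rw [add_smul, exp_add_of_commute (((Commute.refl H).smul_left s).smul_right t)]

theorem exp_smul_mul_exp_neg_smul (H : 𝔸) (t : ℝ) : exp (t • H) * exp (-t • H) = 1 := by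
  rw [exp_smul_mul_exp_smul, add_neg_cancel, zero_smul, exp_zero]

theorem exp_neg_smul_mul_exp_smul (H : 𝔸) (t : ℝ) : exp (-t • H) * exp (t • H) = 1 := by
  rw [exp_smul_mul_exp_smul, neg_add_cancel, zero_smul, exp_zero]

theorem exp_add_smul_one (H : 𝔸) (t : ℝ) : exp (H + t • (1 : 𝔸)) = Real.exp t • exp H := by
  let _ : NormedAlgebra ℚ 𝔸 := NormedAlgebra.restrictScalars ℚ ℝ 𝔸
  rw [exp_add_of_commute ((Commute.one_right H).smul_right t), ← Algebra.algebraMap_eq_smul_one,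
    ← algebraMap_exp_comm, ← Real.exp_eq_exp_ℝ, ← Algebra.commutes, ← Algebra.smul_def]

theorem exp_sub_exp_eq_integral (A B : 𝔸) :
    exp A - exp B = ∫ t in (0 : ℝ)..1, exp (t • A) * (A - B) * exp ((1 - t) • B) := by
  have hderiv (t : ℝ) : HasDerivAt (fun t : ℝ => exp (t • A) * exp ((1 - t) • B))
      (exp (t • A) * (A - B) * exp ((1 - t) • B)) t := by
    have hA := hasDerivAt_exp_smul_const (𝕂 := ℝ) A t
    have hB : HasDerivAt (fun t : ℝ => exp ((1 - t) • B)) (-(B * exp ((1 - t) • B))) t := by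
      simpa [Function.comp_def] using
        (hasDerivAt_exp_smul_const' (𝕂 := ℝ) B (1 - t)).scomp t ((hasDerivAt_id t).const_sub 1)
    exact (hA.mul hB).congr_deriv (by noncomm_ring)
  have hint := intervalIntegral.integral_eq_sub_of_hasDerivAt (fun t _ => hderiv t)
    (Continuous.intervalIntegrable (by fun_prop) 0 1)
  simpa using hint.symm

theorem hasDerivAt_exp_add_smul (H Y : 𝔸) (t : ℝ) :
    HasDerivAt (fun t : ℝ => exp (H + t • Y)) (fderiv ℝ exp (H + t • Y) Y) t := by
  have hline : HasDerivAt (fun t : ℝ => H + t • Y) Y t := by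
    simpa using ((hasDerivAt_id t).smul_const Y).const_add H
  exact (hasStrictFDerivAt_exp _).hasFDerivAt.comp_hasDerivAt t hline

theorem fderiv_exp_apply (H Y : 𝔸) :
    fderiv ℝ exp H Y = ∫ t in (0 : ℝ)..1, exp (t • H) * Y * exp ((1 - t) • H) := by
  let I (ε : ℝ) : 𝔸 := ∫ t in (0 : ℝ)..1, exp (t • (H + ε • Y)) * Y * exp ((1 - t) • H)
  have hI : Continuous I := by
    refine intervalIntegral.continuous_parametric_intervalIntegral_of_continuous' ?_ 0 1
    simp only [Function.uncurry_def]
    fun_prop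
  have hslope (ε : ℝ) : exp (H + ε • Y) - exp H = ε • I ε := by
    simp [I, exp_sub_exp_eq_integral, ← intervalIntegral.integral_smul]
  have hderiv : HasDerivAt (fun ε : ℝ => exp (H + ε • Y)) (I 0) 0 := by
    rw [hasDerivAt_iff_tendsto_slope_zero]
    refine ((hI.tendsto 0).mono_left nhdsWithin_le_nhds).congr' ?_
    filter_upwards [self_mem_nhdsWithin] with ε hε
    rw [zero_add, zero_smul, add_zero, hslope, inv_smul_smul₀ hε]
  simpa [I] using (hasDerivAt_exp_add_smul H Y 0).unique hderiv

theorem eq_exp_mul_mul_exp_of_hasDerivAt {H : 𝔸} {u : ℝ → 𝔸}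
    (hu : ∀ t, HasDerivAt u (H * u t - u t * H) t) (t : ℝ) :
    u t = exp (t • H) * u 0 * exp (-t • H) := by
  have hconst (r : ℝ) : HasDerivAt (fun r : ℝ => exp (-r • H) * u r * exp (r • H)) 0 r := by
    have hpos := hasDerivAt_exp_smul_const' (𝕂 := ℝ) H r
    have hneg : HasDerivAt (fun r : ℝ => exp (-r • H)) (-(exp (-r • H) * H)) r := by
      simpa [Function.comp_def] using
        (hasDerivAt_exp_smul_const (𝕂 := ℝ) H (-r)).scomp r (hasDerivAt_neg r)
    refine ((hneg.mul (hu r)).mul hpos).congr_deriv ?_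
    simp only [Pi.mul_apply]
    noncomm_ring
  have hu0 : exp (-t • H) * u t * exp (t • H) = u 0 := by
    simpa using is_const_of_deriv_eq_zero (fun r => (hconst r).differentiableAt)
      (fun r => (hconst r).deriv) t 0
  calc u t = exp (t • H) * exp (-t • H) * u t * (exp (t • H) * exp (-t • H)) := by
        rw [exp_smul_mul_exp_neg_smul, one_mul, mul_one]
    _ = exp (t • H) * u 0 * exp (-t • H) := by simp only [← hu0, mul_assoc]

theorem exists_hasDerivAt_clm_apply {E : Type*} [NormedAddCommGroup E] [NormedSpace ℝ E]
    [CompleteSpace E] (T : E →L[ℝ] E) (y : E) :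
    ∃ u : ℝ → E, u 0 = y ∧ ∀ t, HasDerivAt u (T (u t)) t := by
  refine ⟨fun t => exp (t • T) y, by simp, fun t => ?_⟩
  simpa using (hasDerivAt_exp_smul_const' (𝕂 := ℝ) T t).clm_apply (hasDerivAt_const t y)

theorem exp_mul_mul_exp_neg_mem {H Y : 𝔸} {S : Submodule ℝ 𝔸} (hS : IsClosed (S : Set 𝔸))
    (had : ∀ X ∈ S, H * X - X * H ∈ S) (hY : Y ∈ S) (t : ℝ) :
    exp (t • H) * Y * exp (-t • H) ∈ S := by
  have : CompleteSpace S := hS.completeSpace_coe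
  let ad : S →L[ℝ] S :=
    (ContinuousLinearMap.mul ℝ 𝔸 H - (ContinuousLinearMap.mul ℝ 𝔸).flip H).restrict had
  obtain ⟨u, hu0, hu⟩ := exists_hasDerivAt_clm_apply ad ⟨Y, hY⟩
  have hderiv (r : ℝ) : HasDerivAt (fun r => (u r : 𝔸)) (H * u r - u r * H) r :=
    S.subtypeL.hasFDerivAt.comp_hasDerivAt r (hu r)
  have hconj := eq_exp_mul_mul_exp_of_hasDerivAt hderiv t
  rw [hu0] at hconj
  exact hconj ▸ (u t).2

theorem exp_mul_fderiv_exp_mul_exp_mem {H Y : 𝔸} {S : Submodule ℝ 𝔸}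
    (hS : IsClosed (S : Set 𝔸)) (had : ∀ X ∈ S, H * X - X * H ∈ S) (hY : Y ∈ S) {s t : ℝ}
    (hst : s + t = -1) : exp (s • H) * fderiv ℝ exp H Y * exp (t • H) ∈ S := by
  let ℓ : 𝔸 →L[ℝ] 𝔸 := (ContinuousLinearMap.mul ℝ 𝔸).flip (exp (t • H)) ∘L
    ContinuousLinearMap.mul ℝ 𝔸 (exp (s • H))
  have hcont : Continuous fun r : ℝ => exp (r • H) * Y * exp ((1 - r) • H) := by fun_prop
  have hconj (r : ℝ) : ℓ (exp (r • H) * Y * exp ((1 - r) • H)) ∈ S := by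
    have hr : (1 - r) + t = -(s + r) := by linarith
    have h : ℓ (exp (r • H) * Y * exp ((1 - r) • H)) =
        exp (s • H) * exp (r • H) * Y * (exp ((1 - r) • H) * exp (t • H)) := by
      simp [ℓ, mul_assoc]
    rw [h, exp_smul_mul_exp_smul, exp_smul_mul_exp_smul, hr]
    exact exp_mul_mul_exp_neg_mem hS had hY (s + r)
  change ℓ (fderiv ℝ exp H Y) ∈ S
  rw [fderiv_exp_apply, ← ℓ.intervalIntegral_comp_comm (hcont.intervalIntegrable 0 1),
    intervalIntegral.integral_of_le zero_le_one]
  have : MeasureTheory.IsProbabilityMeasure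
      (MeasureTheory.volume.restrict (Set.Ioc (0 : ℝ) 1)) := ⟨by simp⟩
  refine Convex.integral_mem S.convex hS (Filter.Eventually.of_forall hconj) ?_
  exact ((intervalIntegrable_iff_integrableOn_Ioc_of_le zero_le_one).1
    ((ℓ.continuous.comp hcont).intervalIntegrable 0 1))

omit [CompleteSpace 𝔸] in
theorem cfc_rpow_exp [StarRing 𝔸] [StarModule ℝ 𝔸]
    [ContinuousFunctionalCalculus ℝ 𝔸 IsSelfAdjoint] {H : 𝔸} (hH : IsSelfAdjoint H) (t : ℝ) :
    cfc (fun x : ℝ => x ^ t) (exp H) = exp (t • H) := by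
  have hcont : ContinuousOn (fun x : ℝ => x ^ t) (Real.exp '' spectrum ℝ H) := by
    rintro _ ⟨x, -, rfl⟩
    exact (Real.continuousAt_rpow_const _ _ (Or.inl (Real.exp_pos x).ne')).continuousWithinAt
  rw [← CFC.real_exp_eq_normedSpace_exp hH, ← cfc_comp (fun x : ℝ => x ^ t) Real.exp H hH hcont,
    ← CFC.real_exp_eq_normedSpace_exp ((IsSelfAdjoint.all t).smul hH), ← cfc_comp_smul t Real.exp H]
  congr 1
  ext x
  simp [← Real.exp_mul, mul_comm]

end Exponential

section Calculus

variable {𝕜 : Type*} [NontriviallyNormedField 𝕜] {E F G : Type*} [NormedAddCommGroup E]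
  [NormedAddCommGroup F] [NormedAddCommGroup G]

theorem apply_deriv_eq_zero_of_eventually_eq_const [NormedSpace 𝕜 E] [NormedSpace 𝕜 F]
    (ℓ : E →L[𝕜] F) {c : F} {σ : 𝕜 → E} {σ' : E} {s : Set 𝕜} {t : 𝕜}
    (hs : UniqueDiffWithinAt 𝕜 s t) (ht : t ∈ s) (hσ : HasDerivWithinAt σ σ' s t)
    (hc : ∀ᶠ r in 𝓝[s] t, ℓ (σ r) = c) : ℓ σ' = 0 :=
  hs.eq_deriv s (ℓ.hasFDerivAt.comp_hasDerivWithinAt t hσ)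
    ((hasDerivWithinAt_const t s c).congr_of_eventuallyEq hc (hc.self_of_nhdsWithin ht))

theorem isSelfAdjoint_deriv [NormedSpace ℝ E] [StarAddMonoid E] [StarModule ℝ E]
    [ContinuousStar E] {σ : ℝ → E} {σ' : E} {s : Set ℝ} {t : ℝ} (hs : UniqueDiffWithinAt ℝ s t)
    (ht : t ∈ s) (hσ : HasDerivWithinAt σ σ' s t)
    (hc : ∀ᶠ r in 𝓝[s] t, IsSelfAdjoint (σ r)) : IsSelfAdjoint σ' :=
  sub_eq_zero.1 (apply_deriv_eq_zero_of_eventually_eq_const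
    ((starL' ℝ : E ≃L[ℝ] E) - ContinuousLinearMap.id ℝ E : E →L[ℝ] E) hs ht hσ
    (hc.mono fun _ hr => sub_eq_zero.2 hr))

theorem exists_hasDerivWithinAt_lift [NormedSpace 𝕜 E] [NormedSpace 𝕜 F] [NormedSpace 𝕜 G]
    [CompleteSpace E] {f : E → G} {f' : E →L[𝕜] G} {x : E} (hf : HasStrictFDerivAt f f' x)
    {m : G →L[𝕜] F} {e : E ≃L[𝕜] F} (he : ∀ y, e y = m (f' y)) {σ : 𝕜 → G} {σ' : G}
    {s : Set 𝕜} {t : 𝕜} (hσ : HasDerivWithinAt σ σ' s t) (hσt : σ t = f x) :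
    ∃ u : 𝕜 → E, u t = x ∧ HasDerivWithinAt u (e.symm (m σ')) s t ∧
      ∀ᶠ r in 𝓝[s] t, m (f (u r)) = m (σ r) := by
  have hmf : HasStrictFDerivAt (fun y => m (f y)) (e : E →L[𝕜] F) x :=
    (m.hasStrictFDerivAt.comp x hf).congr_fderiv (ContinuousLinearMap.ext he).symm
  have hmσ : HasDerivWithinAt (fun r => m (σ r)) (m σ') s t :=
    m.hasFDerivAt.comp_hasDerivWithinAt t hσ
  refine ⟨fun r => hmf.localInverse _ e x (m (σ r)), ?_, ?_, ?_⟩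
  · simp only [hσt, hmf.localInverse_apply_image]
  · exact HasFDerivAt.comp_hasDerivWithinAt t (hσt ▸ hmf.to_localInverse.hasFDerivAt) hmσ
  · exact (hσt ▸ hmσ.continuousWithinAt.tendsto).eventually hmf.eventually_right_inverse

theorem exists_continuousLinearEquiv_eq_of_apply_self_pos [NormedSpace ℝ E]
    [FiniteDimensional ℝ E] {B : E →L[ℝ] E →L[ℝ] ℝ} (hB : ∀ x, x ≠ 0 → 0 < B x x) :
    ∃ e : E ≃L[ℝ] (E →L[ℝ] ℝ), (e : E →L[ℝ] E →L[ℝ] ℝ) = B := by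
  have hinj : Function.Injective B := (injective_iff_map_eq_zero B).2 fun x hx => by
    by_contra hx0
    exact (hB x hx0).ne' (by rw [hx, zero_apply])
  have hrank : Module.finrank ℝ E = Module.finrank ℝ (E →L[ℝ] ℝ) :=
    Subspace.dual_finrank_eq.symm.trans LinearMap.toContinuousLinearMap.finrank_eq
  exact ⟨(LinearEquiv.ofInjectiveOfFinrankEq B.toLinearMap hinj hrank).toContinuousLinearEquiv,
    rfl⟩

end Calculus

section FaithfulTrace

open NormedSpace

variable {𝔸 : Type*} [NormedRing 𝔸] [NormedAlgebra ℝ 𝔸] [StarRing 𝔸]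

/-- A real-valued faithful trace on a normed star algebra, with values in `ℝ` so that it
serves as a real inner product; for complex matrices it is the real part of the trace. -/
structure IsFaithfulTrace (τ : 𝔸 →L[ℝ] ℝ) : Prop where
  mul_comm : ∀ x y, τ (x * y) = τ (y * x)
  star_mul_self_pos : ∀ x, x ≠ 0 → 0 < τ (star x * x)

variable [CompleteSpace 𝔸] [StarModule ℝ 𝔸] [ContinuousStar 𝔸] {τ : 𝔸 →L[ℝ] ℝ}

namespace IsFaithfulTrace

theorem star_mul_exp_mul_mul_exp_pos (hτ : IsFaithfulTrace τ) {H A : 𝔸} (hH : IsSelfAdjoint H)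
    (hA : A ≠ 0) (s t : ℝ) : 0 < τ (star A * (exp (s • H) * A * exp (t • H))) := by
  have hstar (r : ℝ) : star (exp (r • H)) = exp (r • H) :=
    (((IsSelfAdjoint.all r).smul hH).exp).star_eq
  have hhalf (r : ℝ) : exp (r • H) = exp ((r / 2) • H) * exp ((r / 2) • H) := by
    rw [exp_smul_mul_exp_smul, add_halves]
  let B := exp ((s / 2) • H) * A * exp ((t / 2) • H)
  have hAB : A = exp (-(s / 2) • H) * B * exp (-(t / 2) • H) := by
    calc A = exp (-(s / 2) • H) * exp ((s / 2) • H) * A *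
          (exp ((t / 2) • H) * exp (-(t / 2) • H)) := by
          rw [exp_smul_mul_exp_neg_smul, exp_neg_smul_mul_exp_smul, one_mul, mul_one]
      _ = exp (-(s / 2) • H) * B * exp (-(t / 2) • H) := by simp only [B, mul_assoc]
  have hB : B ≠ 0 := fun hB => hA (by rw [hAB, hB, mul_zero, zero_mul])
  have htrace : τ (star B * B) = τ (star A * (exp (s • H) * A * exp (t • H))) := by
    simp only [B, star_mul, hstar, hhalf s, hhalf t]
    rw [mul_assoc, hτ.mul_comm]
    simp only [mul_assoc]
  exact htrace ▸ hτ.star_mul_self_pos B hB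

theorem apply_exp_pos [Nontrivial 𝔸] (hτ : IsFaithfulTrace τ) {H : 𝔸} (hH : IsSelfAdjoint H) :
    0 < τ (exp H) := by
  simpa using hτ.star_mul_exp_mul_mul_exp_pos hH one_ne_zero 0 1

theorem mul_fderiv_exp_pos (hτ : IsFaithfulTrace τ) {H Y : 𝔸} (hH : IsSelfAdjoint H)
    (hY : IsSelfAdjoint Y) (hY0 : Y ≠ 0) : 0 < τ (Y * fderiv ℝ exp H Y) := by
  let ℓ : 𝔸 →L[ℝ] ℝ := τ ∘L ContinuousLinearMap.mul ℝ 𝔸 Y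
  have hcont : Continuous fun t : ℝ => exp (t • H) * Y * exp ((1 - t) • H) := by fun_prop
  change 0 < ℓ (fderiv ℝ exp H Y)
  rw [fderiv_exp_apply, ← ℓ.intervalIntegral_comp_comm (hcont.intervalIntegrable 0 1)]
  refine intervalIntegral.intervalIntegral_pos_of_pos_on
    ((ℓ.continuous.comp hcont).intervalIntegrable 0 1) (fun t _ => ?_) zero_lt_one
  have h := hτ.star_mul_exp_mul_mul_exp_pos hH hY0 t (1 - t)
  rwa [hY.star_eq] at h

theorem eq_of_apply_sub_mul_exp_eq (hτ : IsFaithfulTrace τ) {Y Z : 𝔸} (hY : IsSelfAdjoint Y)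
    (hZ : IsSelfAdjoint Z) (h : τ ((Z - Y) * exp Y) = τ ((Z - Y) * exp Z)) : Y = Z := by
  by_contra hne
  have hD : IsSelfAdjoint (Z - Y) := hZ.sub hY
  have hderiv (t : ℝ) : HasDerivAt (fun t : ℝ => τ ((Z - Y) * exp (Y + t • (Z - Y))))
      (τ ((Z - Y) * fderiv ℝ exp (Y + t • (Z - Y)) (Z - Y))) t :=
    τ.hasFDerivAt.comp_hasDerivAt t ((hasDerivAt_exp_add_smul Y (Z - Y) t).const_mul _)
  have hmono : StrictMono fun t : ℝ => τ ((Z - Y) * exp (Y + t • (Z - Y))) := by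
    refine strictMono_of_deriv_pos fun t => ?_
    rw [(hderiv t).deriv]
    exact hτ.mul_fderiv_exp_pos (hY.add ((IsSelfAdjoint.all t).smul hD)) hD
      (sub_ne_zero.2 (Ne.symm hne))
  have := hmono zero_lt_one
  simp [h] at this

end IsFaithfulTrace

end FaithfulTrace

section ExponentialFamily

open NormedSpace

variable {𝔸 : Type*} [NormedRing 𝔸] [NormedAlgebra ℝ 𝔸]

/-- The moments `Z ↦ τ (Z A)` of `A` with respect to the observables `Z ∈ R`. They serve as
coordinates on the exponential family generated by `R`. -/
noncomputable def momentMap (τ : 𝔸 →L[ℝ] ℝ) (R : Submodule ℝ 𝔸) : 𝔸 →L[ℝ] (R →L[ℝ] ℝ) :=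
  ((ContinuousLinearMap.compL ℝ R 𝔸 ℝ).flip R.subtypeL) ∘L
    (ContinuousLinearMap.compL ℝ 𝔸 𝔸 ℝ τ ∘L (ContinuousLinearMap.mul ℝ 𝔸).flip)

/-- The exponential family generated by `R`: the exponentials of elements of `R` that are
normalized by `τ`. -/
def expFamily (τ : 𝔸 →L[ℝ] ℝ) (R : Submodule ℝ 𝔸) : Set 𝔸 :=
  {ρ | ρ ∈ exp '' (R : Set 𝔸) ∧ τ ρ = 1}

/-- The tangent space of `expFamily τ R` at `exp H`, when `τ (exp H) = 1`: the derivatives of `exp`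
at `H` along `R` that preserve the normalization. -/
noncomputable def expTangentSpace (τ : 𝔸 →L[ℝ] ℝ) (R : Submodule ℝ 𝔸) (H : 𝔸) : Submodule ℝ 𝔸 :=
  R.map (fderiv ℝ exp H).toLinearMap ⊓ τ.ker

variable {τ : 𝔸 →L[ℝ] ℝ} {R : Submodule ℝ 𝔸} {H X : 𝔸}

@[simp]
theorem momentMap_apply (A : 𝔸) (Z : R) : momentMap τ R A Z = τ (Z * A) := rfl

theorem momentMap_eq_iff {A B : 𝔸} :
    momentMap τ R A = momentMap τ R B ↔ ∀ Z ∈ R, τ (Z * A) = τ (Z * B) := by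
  simp [ContinuousLinearMap.ext_iff]

theorem apply_eq_of_momentMap_eq (h1 : 1 ∈ R) {A B : 𝔸} (h : momentMap τ R A = momentMap τ R B) :
    τ A = τ B := by
  simpa using momentMap_eq_iff.1 h 1 h1

variable [CompleteSpace 𝔸] [StarRing 𝔸] [StarModule ℝ 𝔸] [ContinuousStar 𝔸]

theorem isSelfAdjoint_of_mem_expTangentSpace (hR : ∀ Y ∈ R, IsSelfAdjoint Y) (hH : H ∈ R) :
    ∀ A ∈ expTangentSpace τ R H, IsSelfAdjoint A := by
  rintro _ ⟨⟨Y, hY, rfl⟩, -⟩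
  have hderiv : HasDerivAt (fun r : ℝ => exp (H + r • Y)) (fderiv ℝ exp H Y) 0 := by
    simpa using hasDerivAt_exp_add_smul H Y 0
  exact isSelfAdjoint_deriv uniqueDiffWithinAt_univ (Set.mem_univ 0) hderiv.hasDerivWithinAt
    (.of_forall fun r => (hR _ (R.add_mem hH (R.smul_mem r hY))).exp)

theorem injOn_momentMap_expFamily (hτ : IsFaithfulTrace τ) (hR : ∀ Y ∈ R, IsSelfAdjoint Y) :
    Set.InjOn (momentMap τ R) (expFamily τ R) := by
  rintro _ ⟨⟨Y, hY, rfl⟩, -⟩ _ ⟨⟨Z, hZ, rfl⟩, -⟩ h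
  rw [hτ.eq_of_apply_sub_mul_exp_eq (hR Y hY) (hR Z hZ)
    (momentMap_eq_iff.1 h (Z - Y) (R.sub_mem hZ hY))]

variable [FiniteDimensional ℝ R]

theorem exists_continuousLinearEquiv_momentMap_fderiv_exp (hτ : IsFaithfulTrace τ)
    (hR : ∀ Y ∈ R, IsSelfAdjoint Y) (hH : H ∈ R) :
    ∃ e : R ≃L[ℝ] (R →L[ℝ] ℝ), ∀ Y : R, e Y = momentMap τ R (fderiv ℝ exp H Y) := by
  obtain ⟨e, he⟩ := exists_continuousLinearEquiv_eq_of_apply_self_pos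
    (B := momentMap τ R ∘L fderiv ℝ exp H ∘L R.subtypeL) fun Y hY =>
      hτ.mul_fderiv_exp_pos (hR H hH) (hR Y Y.2) (by simpa using hY)
  exact ⟨e, fun Y => congrArg (· Y) he⟩

theorem injOn_momentMap_expTangentSpace (hτ : IsFaithfulTrace τ)
    (hR : ∀ Y ∈ R, IsSelfAdjoint Y) (hH : H ∈ R) :
    Set.InjOn (momentMap τ R) (expTangentSpace τ R H) := by
  obtain ⟨e, he⟩ := exists_continuousLinearEquiv_momentMap_fderiv_exp hτ hR hH
  rintro _ ⟨⟨Y, hY, rfl⟩, -⟩ _ ⟨⟨Z, hZ, rfl⟩, -⟩ h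
  have heq : (⟨Y, hY⟩ : R) = ⟨Z, hZ⟩ :=
    e.injective (((he ⟨Y, hY⟩).trans h).trans (he ⟨Z, hZ⟩).symm)
  rw [Subtype.mk.inj heq]

theorem exists_mem_expTangentSpace_momentMap_eq (hτ : IsFaithfulTrace τ)
    (hR : ∀ Y ∈ R, IsSelfAdjoint Y) (h1 : 1 ∈ R) (hH : H ∈ R) (hX : τ X = 0) :
    ∃ A ∈ expTangentSpace τ R H, momentMap τ R A = momentMap τ R X := by
  obtain ⟨e, he⟩ := exists_continuousLinearEquiv_momentMap_fderiv_exp hτ hR hH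
  obtain ⟨Y, hY⟩ := e.surjective (momentMap τ R X)
  have hA : momentMap τ R (fderiv ℝ exp H Y) = momentMap τ R X :=
    (he Y).symm.trans hY
  exact ⟨fderiv ℝ exp H Y, ⟨⟨Y, Y.2, rfl⟩, (apply_eq_of_momentMap_eq h1 hA).trans hX⟩, hA⟩

variable {σ : ℝ → 𝔸} {s : Set ℝ} {t : ℝ} {A : 𝔸}

theorem exists_curve_exp_momentMap_eq (hτ : IsFaithfulTrace τ) (hR : ∀ Y ∈ R, IsSelfAdjoint Y)
    (hH : H ∈ R) (hA : A ∈ expTangentSpace τ R H) (hAX : momentMap τ R A = momentMap τ R X)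
    (hσ : HasDerivWithinAt σ X s t) (hσt : σ t = exp H) :
    ∃ u : ℝ → R, HasDerivWithinAt (fun r => exp (u r : 𝔸)) A s t ∧
      ∀ᶠ r in 𝓝[s] t, momentMap τ R (exp (u r : 𝔸)) = momentMap τ R (σ r) := by
  obtain ⟨e, he⟩ := exists_continuousLinearEquiv_momentMap_fderiv_exp hτ hR hH
  obtain ⟨⟨Y, hY, rfl⟩, -⟩ := hA
  obtain ⟨u, hut, hu, hmoment⟩ := exists_hasDerivWithinAt_lift (F := R →L[ℝ] ℝ) (m := momentMap τ R)
    ((hasStrictFDerivAt_exp H).comp ⟨H, hH⟩ R.subtypeL.hasStrictFDerivAt) he hσ hσt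
  have hYX : e.symm (momentMap τ R X) = ⟨Y, hY⟩ :=
    e.symm_apply_eq.2 (hAX.symm.trans (he ⟨Y, hY⟩).symm)
  rw [hYX] at hu
  have hexp : HasFDerivAt exp (fderiv ℝ exp H) (u t : 𝔸) := by
    rw [hut]
    exact (hasStrictFDerivAt_exp H).hasFDerivAt
  exact ⟨u, hexp.comp_hasDerivWithinAt t (R.subtypeL.hasFDerivAt.comp_hasDerivWithinAt t hu),
    hmoment⟩

theorem eventually_existsUnique_mem_expFamily (hτ : IsFaithfulTrace τ)
    (hR : ∀ Y ∈ R, IsSelfAdjoint Y) (h1 : 1 ∈ R) (hH : H ∈ R)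
    (hA : A ∈ expTangentSpace τ R H) (hAX : momentMap τ R A = momentMap τ R X)
    (hσ : HasDerivWithinAt σ X s t) (hσt : σ t = exp H) (hσs : ∀ᶠ r in 𝓝[s] t, τ (σ r) = 1) :
    ∀ᶠ r in 𝓝[s] t, ∃! ρ, ρ ∈ expFamily τ R ∧ momentMap τ R ρ = momentMap τ R (σ r) := by
  obtain ⟨u, -, hmoment⟩ := exists_curve_exp_momentMap_eq hτ hR hH hA hAX hσ hσt
  filter_upwards [hmoment, hσs] with r hr hσr
  have hmem : exp (u r : 𝔸) ∈ expFamily τ R :=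
    ⟨⟨u r, (u r).2, rfl⟩, (apply_eq_of_momentMap_eq h1 hr).trans hσr⟩
  exact ⟨_, ⟨hmem, hr⟩, fun ρ hρ =>
    injOn_momentMap_expFamily hτ hR hρ.1 hmem (hρ.2.trans hr.symm)⟩

theorem hasDerivWithinAt_of_momentMap_eq (hτ : IsFaithfulTrace τ)
    (hR : ∀ Y ∈ R, IsSelfAdjoint Y) (h1 : 1 ∈ R) (hH : H ∈ R)
    (hA : A ∈ expTangentSpace τ R H) (hAX : momentMap τ R A = momentMap τ R X)
    (hσ : HasDerivWithinAt σ X s t) (hσt : σ t = exp H) (ht : t ∈ s) {γ : ℝ → 𝔸}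
    (hγ : ∀ᶠ r in 𝓝[s] t, γ r ∈ expFamily τ R ∧ momentMap τ R (γ r) = momentMap τ R (σ r)) :
    HasDerivWithinAt γ A s t := by
  obtain ⟨u, hu, hmoment⟩ := exists_curve_exp_momentMap_eq hτ hR hH hA hAX hσ hσt
  have heq : ∀ᶠ r in 𝓝[s] t, γ r = exp (u r : 𝔸) := by
    filter_upwards [hγ, hmoment] with r ⟨hmem, hr⟩ hur
    have hmoments := hr.trans hur.symm
    exact injOn_momentMap_expFamily hτ hR hmem
      ⟨⟨u r, (u r).2, rfl⟩, (apply_eq_of_momentMap_eq h1 hmoments).symm.trans hmem.2⟩ hmoments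
  exact hu.congr_of_eventuallyEq heq (heq.self_of_nhdsWithin ht)

omit [FiniteDimensional ℝ R] in
theorem inv_smul_exp_mem_expFamily [Nontrivial 𝔸] (hτ : IsFaithfulTrace τ)
    (hR : ∀ Y ∈ R, IsSelfAdjoint Y) (h1 : 1 ∈ R) (hH : H ∈ R) :
    (τ (exp H))⁻¹ • exp H ∈ expFamily τ R := by
  have hpos := hτ.apply_exp_pos (hR H hH)
  refine ⟨⟨H + Real.log (τ (exp H))⁻¹ • (1 : 𝔸), R.add_mem hH (R.smul_mem _ h1), ?_⟩, ?_⟩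
  · rw [exp_add_smul_one, Real.exp_log (inv_pos.2 hpos)]
  · rw [map_smul, smul_eq_mul, inv_mul_cancel₀ hpos.ne']

theorem mem_expTangentSpace_iff_exists_curve (hτ : IsFaithfulTrace τ)
    (hR : ∀ Y ∈ R, IsSelfAdjoint Y) (h1 : 1 ∈ R) (hH : H ∈ R) (hH1 : τ (exp H) = 1) :
    A ∈ expTangentSpace τ R H ↔
      ∃ γ : ℝ → 𝔸, (∀ r, γ r ∈ expFamily τ R) ∧ γ 0 = exp H ∧ HasDerivAt γ A 0 := by
  constructor
  · rintro ⟨⟨Y, hY, rfl⟩, hker⟩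
    have : Nontrivial 𝔸 := ⟨exp H, 0, fun h => by simp [h] at hH1⟩
    let γ (r : ℝ) : 𝔸 := (τ (exp (H + r • Y)))⁻¹ • exp (H + r • Y)
    have hexp : HasDerivAt (fun r : ℝ => exp (H + r • Y)) (fderiv ℝ exp H Y) 0 := by
      simpa using hasDerivAt_exp_add_smul H Y 0
    have hnorm : HasDerivAt (fun r : ℝ => (τ (exp (H + r • Y)))⁻¹) 0 0 := by
      have hker' : τ (fderiv ℝ exp H Y) = 0 := hker
      have := (τ.hasFDerivAt.comp_hasDerivAt 0 hexp).inv (by simp [hH1])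
      simpa [Function.comp_def, Pi.inv_def, hker'] using this
    refine ⟨γ, fun r => ?_, by simp [γ, hH1], ?_⟩
    · exact inv_smul_exp_mem_expFamily hτ hR h1 (R.add_mem hH (R.smul_mem r hY))
    · exact (hnorm.smul hexp).congr_deriv (by simp [hH1])
  · rintro ⟨γ, hγ, hγ0, hderiv⟩
    have hA : τ A = 0 := apply_deriv_eq_zero_of_eventually_eq_const τ uniqueDiffWithinAt_univ
      (Set.mem_univ 0) hderiv.hasDerivWithinAt (Filter.Eventually.of_forall fun r => (hγ r).2)
    obtain ⟨B, hB, hBA⟩ := exists_mem_expTangentSpace_momentMap_eq hτ hR h1 hH hA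
    have hderiv' := hasDerivWithinAt_of_momentMap_eq hτ hR h1 hH hB hBA
      hderiv.hasDerivWithinAt hγ0 (Set.mem_univ 0) (.of_forall fun r => ⟨hγ r, rfl⟩)
    rwa [hderiv.unique (hasDerivWithinAt_univ.1 hderiv')]

end ExponentialFamily

section Majorana

open Matrix

variable {N : ℕ} {n : Type*}

/-- The coefficient of `a_j†` in the Majorana operator `majorana a (j, p)`; it treats both types
of Majorana operators at once. -/
def majoranaPhase (p : Fin 2) : ℂ :=
  if p = 0 then 1 else -Complex.I

theorem majorana_eq (a : Fin N → Matrix n n ℂ) (k : Fin N × Fin 2) :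
    majorana a k = majoranaPhase k.2 • (a k.1)ᴴ + star (majoranaPhase k.2) • a k.1 := by
  unfold majorana majoranaPhase
  split_ifs
  · simp
  · simp [sub_eq_add_neg]

theorem majoranaPhase_mul_star_add (p q : Fin 2) :
    majoranaPhase p * star (majoranaPhase q) + star (majoranaPhase p) * majoranaPhase q =
      if p = q then 2 else 0 := by
  fin_cases p <;> fin_cases q <;> simp [majoranaPhase, one_add_one_eq_two]

theorem isHermitian_majorana (a : Fin N → Matrix n n ℂ) (k : Fin N × Fin 2) :
    (majorana a k).IsHermitian := by
  simp [majorana_eq, Matrix.IsHermitian, add_comm]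

variable [Fintype n]

/-- The complex span of `1` and the quadratic Majorana monomials, which the metrics
`Ω_ρ^α` map tangent vectors into. -/
def quadSpan [DecidableEq n] (a : Fin N → Matrix n n ℂ) : Submodule ℂ (Matrix n n ℂ) :=
  Submodule.span ℂ (insert 1 (Set.range fun p : (Fin N × Fin 2) × (Fin N × Fin 2) =>
    majorana a p.1 * majorana a p.2))

theorem quadraticForm_add (a : Fin N → Matrix n n ℂ)
    (K K' : Matrix (Fin N × Fin 2) (Fin N × Fin 2) ℝ) :
    quadraticForm a (K + K') = quadraticForm a K + quadraticForm a K' := by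
  simp [quadraticForm, add_smul, Finset.sum_add_distrib]

theorem quadraticForm_smul (a : Fin N → Matrix n n ℂ) (r : ℝ)
    (K : Matrix (Fin N × Fin 2) (Fin N × Fin 2) ℝ) :
    quadraticForm a (r • K) = r • quadraticForm a K := by
  rw [← Complex.coe_smul]
  simp only [quadraticForm, Matrix.smul_apply, smul_eq_mul, Complex.ofReal_mul, mul_smul,
    ← Finset.smul_sum]
  rw [smul_comm]

theorem isHermitian_quadraticForm (a : Fin N → Matrix n n ℂ)
    {K : Matrix (Fin N × Fin 2) (Fin N × Fin 2) ℝ} (hK : Kᵀ = -K) :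
    (quadraticForm a K).IsHermitian := by
  have hK' (k l) : K k l = -K l k := congrFun (congrFun hK l) k
  have hsum : (∑ k, ∑ l, (K k l : ℂ) • (majorana a k * majorana a l))ᴴ =
      -∑ k, ∑ l, (K k l : ℂ) • (majorana a k * majorana a l) := by
    simp only [conjTranspose_sum, conjTranspose_smul, conjTranspose_mul,
      (isHermitian_majorana a _).eq, ← Finset.sum_neg_distrib]
    rw [Finset.sum_comm]
    refine Finset.sum_congr rfl fun k _ => Finset.sum_congr rfl fun l _ => ?_
    simp [hK' k l]
  rw [Matrix.IsHermitian, quadraticForm, conjTranspose_smul, hsum, smul_neg, ← neg_smul]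
  simp [neg_div]

variable [DecidableEq n]

/-- The real space spanned by `1` and the Hermitian quadratic forms in the Majorana operators. It
generates the Gaussian states as an exponential family: the summand `1` absorbs the factor `κ`. -/
def quadSpace (a : Fin N → Matrix n n ℂ) : Submodule ℝ (Matrix n n ℂ) where
  carrier := {X | ∃ K : Matrix (Fin N × Fin 2) (Fin N × Fin 2) ℝ, Kᵀ = -K ∧
    ∃ r : ℝ, quadraticForm a K + r • (1 : Matrix n n ℂ) = X}
  add_mem' := by
    rintro _ _ ⟨K, hK, r, rfl⟩ ⟨K', hK', r', rfl⟩
    exact ⟨K + K', by simp [hK, hK', add_comm], r + r', by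
      rw [quadraticForm_add, add_smul, add_add_add_comm]⟩
  zero_mem' := ⟨0, by simp, 0, by simp [quadraticForm]⟩
  smul_mem' := by
    rintro t _ ⟨K, hK, r, rfl⟩
    exact ⟨t • K, by simp [hK], t * r, by rw [quadraticForm_smul, smul_add, smul_smul]⟩

variable {a : Fin N → Matrix n n ℂ}

theorem one_mem_quadSpan : 1 ∈ quadSpan a :=
  Submodule.subset_span (Set.mem_insert _ _)

theorem majorana_mul_majorana_mem_quadSpan (k l : Fin N × Fin 2) :
    majorana a k * majorana a l ∈ quadSpan a :=
  Submodule.subset_span (Set.mem_insert_of_mem _ ⟨(k, l), rfl⟩)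

theorem one_mem_quadSpace : 1 ∈ quadSpace a :=
  ⟨0, by simp, 1, by simp [quadraticForm]⟩

theorem quadraticForm_mem_quadSpace {K : Matrix (Fin N × Fin 2) (Fin N × Fin 2) ℝ}
    (hK : Kᵀ = -K) : quadraticForm a K ∈ quadSpace a :=
  ⟨K, hK, 0, by simp⟩

theorem isSelfAdjoint_of_mem_quadSpace : ∀ X ∈ quadSpace a, IsSelfAdjoint X := by
  rintro _ ⟨K, hK, r, rfl⟩
  exact (isHermitian_quadraticForm a hK).add ((IsSelfAdjoint.all r).smul isHermitian_one)

theorem quadSpace_le_quadSpan : quadSpace a ≤ (quadSpan a).restrictScalars ℝ := by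
  rintro _ ⟨K, -, r, rfl⟩
  refine add_mem (Submodule.smul_mem (quadSpan a) _ ?_)
    (Submodule.smul_mem _ r one_mem_quadSpan)
  exact sum_mem fun k _ => sum_mem fun l _ =>
    Submodule.smul_mem _ _ (majorana_mul_majorana_mem_quadSpan k l)

theorem majorana_mul_add_mul (ha : IsCAR a) (k l : Fin N × Fin 2) :
    majorana a k * majorana a l + majorana a l * majorana a k =
      (if k = l then (2 : ℂ) else 0) • (1 : Matrix n n ℂ) := by
  obtain ⟨i, p⟩ := k
  obtain ⟨j, q⟩ := l
  have hstar : (a i)ᴴ * (a j)ᴴ + (a j)ᴴ * (a i)ᴴ = 0 := by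
    simpa using congrArg conjTranspose (ha.anticomm j i)
  have hswap : a i * (a j)ᴴ + (a j)ᴴ * a i = if i = j then 1 else 0 := by
    rw [add_comm, ha.anticomm_star j i]
    simp only [eq_comm]
  set u := majoranaPhase p with hu
  set v := majoranaPhase q with hv
  calc majorana a (i, p) * majorana a (j, q) + majorana a (j, q) * majorana a (i, p)
      = (u * v) • ((a i)ᴴ * (a j)ᴴ + (a j)ᴴ * (a i)ᴴ) +
          (u * star v) • ((a i)ᴴ * a j + a j * (a i)ᴴ) +
          (star u * v) • (a i * (a j)ᴴ + (a j)ᴴ * a i) +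
          (star u * star v) • (a i * a j + a j * a i) := by
        simp only [majorana_eq, add_mul, mul_add, smul_mul_smul_comm, smul_add, ← hu, ← hv]
        simp only [mul_comm v, mul_comm (star v)]
        abel
    _ = (u * star v + star u * v) • if i = j then 1 else 0 := by
        rw [hstar, hswap, ha.anticomm_star, ha.anticomm, smul_zero, smul_zero, zero_add, add_zero,
          add_smul]
    _ = _ := by
        rw [majoranaPhase_mul_star_add]
        by_cases hij : i = j <;> simp [hij]

theorem commutator_mul_mul {R A : Type*} [CommRing R] [Ring A] [Algebra R A] {k l m p : A}
    {x y z w : R}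
    (hx : l * m + m * l = x • 1) (hy : k * m + m * k = y • 1)
    (hz : l * p + p * l = z • 1) (hw : k * p + p * k = w • 1) :
    k * l * (m * p) - m * p * (k * l) =
      x • (k * p) - y • (l * p) + z • (m * k) - w • (m * l) := by
  have h : k * l * (m * p) - m * p * (k * l) = k * (l * m + m * l) * p -
      (k * m + m * k) * l * p + m * k * (l * p + p * l) - m * (k * p + p * k) * l := by
    noncomm_ring
  simpa [hx, hy, hz, hw] using h

theorem commutator_mem_quadSpan (ha : IsCAR a) {X Y : Matrix n n ℂ} (hX : X ∈ quadSpan a)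
    (hY : Y ∈ quadSpan a) : X * Y - Y * X ∈ quadSpan a := by
  refine LinearMap.BilinMap.apply_apply_mem_of_mem_span (quadSpan a) _ _
    (LinearMap.mul ℂ (Matrix n n ℂ) - (LinearMap.mul ℂ (Matrix n n ℂ)).flip) ?_ X Y hX hY
  rintro _ (rfl | ⟨⟨k, l⟩, rfl⟩) _ (rfl | ⟨⟨m, p⟩, rfl⟩)
  · simp
  · simp
  · simp
  · have hmem := majorana_mul_majorana_mem_quadSpan (a := a)
    change majorana a k * majorana a l * (majorana a m * majorana a p) -
      majorana a m * majorana a p * (majorana a k * majorana a l) ∈ quadSpan a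
    rw [commutator_mul_mul (majorana_mul_add_mul ha l m) (majorana_mul_add_mul ha k m)
      (majorana_mul_add_mul ha l p) (majorana_mul_add_mul ha k p)]
    exact sub_mem (add_mem (sub_mem (Submodule.smul_mem _ _ (hmem k p))
      (Submodule.smul_mem _ _ (hmem l p))) (Submodule.smul_mem _ _ (hmem m k)))
      (Submodule.smul_mem _ _ (hmem m l))

omit [DecidableEq n] in
theorem quadraticForm_single_sub_single (k l : Fin N × Fin 2) :
    quadraticForm a (single k l 1 - single l k 1) =
      (-(Complex.I / 2)) • (majorana a k * majorana a l - majorana a l * majorana a k) := by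
  simp [quadraticForm, sub_smul, Finset.sum_sub_distrib, single_apply, ite_and]

theorem majorana_mul_majorana_eq (ha : IsCAR a) (k l : Fin N × Fin 2) :
    majorana a k * majorana a l = (if k = l then (1 : ℂ) else 0) • (1 : Matrix n n ℂ) +
      Complex.I • quadraticForm a (single k l 1 - single l k 1) := by
  have hI : Complex.I * -(Complex.I / 2) = 1 / 2 := by
    linear_combination (-1 / 2 : ℂ) * Complex.I_sq
  have hδ : (if k = l then (1 : ℂ) else 0) = 1 / 2 * if k = l then 2 else 0 := by
    split_ifs <;> norm_num
  rw [quadraticForm_single_sub_single, smul_smul, hI, hδ, mul_smul, ← majorana_mul_add_mul ha]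
  module

theorem covariance_apply (ha : IsCAR a) (σ : Matrix n n ℂ) (k l : Fin N × Fin 2) :
    covariance a σ k l = Complex.I *
      ((majorana a k * majorana a l * σ).trace - (if k = l then (1 : ℂ) else 0) * σ.trace) := by
  have hcomm : majorana a k * majorana a l - majorana a l * majorana a k =
      (2 : ℂ) • (majorana a k * majorana a l) -
        (if k = l then (2 : ℂ) else 0) • (1 : Matrix n n ℂ) := by
    rw [← majorana_mul_add_mul ha]
    module
  rw [covariance, of_apply, hcomm, sub_mul, smul_mul_assoc, smul_mul_assoc, one_mul, trace_sub,
    trace_smul, trace_smul, smul_eq_mul, smul_eq_mul]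
  split_ifs <;> ring

theorem covariance_eq_iff (ha : IsCAR a) {A B : Matrix n n ℂ} (htr : A.trace = B.trace) :
    covariance a A = covariance a B ↔ ∀ k l,
      (majorana a k * majorana a l * A).trace = (majorana a k * majorana a l * B).trace := by
  simp [← Matrix.ext_iff, covariance_apply ha, htr, Complex.I_ne_zero]

theorem forall_mem_quadSpan_trace_mul_eq_iff {A B : Matrix n n ℂ} :
    (∀ Z ∈ quadSpan a, (Z * A).trace = (Z * B).trace) ↔ A.trace = B.trace ∧ ∀ k l,
      (majorana a k * majorana a l * A).trace = (majorana a k * majorana a l * B).trace := by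
  refine ⟨fun h => ⟨by simpa using h 1 one_mem_quadSpan,
    fun k l => h _ (majorana_mul_majorana_mem_quadSpan k l)⟩, fun ⟨htr, hmaj⟩ Z hZ => ?_⟩
  refine LinearMap.eqOn_span (f := traceLinearMap n ℂ ℂ ∘ₗ LinearMap.mulRight ℂ A)
    (g := traceLinearMap n ℂ ℂ ∘ₗ LinearMap.mulRight ℂ B) ?_ hZ
  rintro _ (rfl | ⟨⟨k, l⟩, rfl⟩)
  · simpa using htr
  · exact hmaj k l

end Majorana

section Coordinates

theorem eq_sum_smul_basis_iff {R M ι : Type*} [Ring R] [AddCommGroup M] [Module R M] [Fintype ι]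
    {T : Submodule R M} (b : Module.Basis ι R T) {x : M} (hx : x ∈ T) (w : ι → R) :
    x = ∑ j, w j • (b j : M) ↔ w = b.repr ⟨x, hx⟩ := by
  have hcoe : ∑ j, w j • (b j : M) = (∑ j, w j • b j : T) := by simp
  rw [hcoe, ← Subtype.ext_iff (a1 := ⟨x, hx⟩), ← b.equivFun_symm_apply, ← LinearEquiv.symm_apply_eq,
    LinearEquiv.symm_symm, eq_comm]
  rfl

end Coordinates

section GaussianStates

open Matrix NormedSpace
open scoped MatrixOrder Matrix.Norms.L2Operator

theorem eventually_nonneg_add_smul {A : Type*} [CStarAlgebra A] [PartialOrder A]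
    [StarOrderedRing A] {x y : A} (hx : IsStrictlyPositive x) (hy : IsSelfAdjoint y) :
    ∀ᶠ s in 𝓝 (0 : ℝ), 0 ≤ x + s • y := by
  nontriviality A
  obtain ⟨r, hr, hrx⟩ :=
    (CFC.exists_pos_algebraMap_le_iff hx.isSelfAdjoint).2 fun _ => hx.spectrum_pos
  have hsmall : ∀ᶠ s in 𝓝 (0 : ℝ), ‖s • y‖ < r := by
    have hcont : Continuous fun s : ℝ => ‖s • y‖ := by fun_prop
    exact hcont.continuousAt.eventually_lt_const (by simpa using hr)
  filter_upwards [hsmall] with s hs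
  have hsy : IsSelfAdjoint (s • y) := (IsSelfAdjoint.all s).smul hy
  calc (0 : A) = algebraMap ℝ A r + -algebraMap ℝ A r := (add_neg_cancel _).symm
    _ ≤ x + -algebraMap ℝ A ‖s • y‖ :=
      add_le_add hrx (neg_le_neg (algebraMap_mono A hs.le))
    _ ≤ x + s • y := by
      gcongr
      exact hsy.neg_algebraMap_norm_le_self

variable {N : ℕ} {n : Type*} [Fintype n]

/-- The real part of the trace, as a continuous real linear functional. -/
noncomputable def reTrace : Matrix n n ℂ →L[ℝ] ℝ :=
  LinearMap.toContinuousLinearMap (Complex.reLm ∘ₗ traceLinearMap n ℝ ℂ)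

@[simp]
theorem reTrace_apply (A : Matrix n n ℂ) : reTrace A = A.trace.re := rfl

theorem ofReal_reTrace {A : Matrix n n ℂ} (hA : A.IsHermitian) : (reTrace A : ℂ) = A.trace :=
  Complex.conj_eq_iff_re.1 ((trace_conjTranspose A).symm.trans (congrArg trace hA))

theorem ofReal_reTrace_mul {A B : Matrix n n ℂ} (hA : A.IsHermitian) (hB : B.IsHermitian) :
    (reTrace (A * B) : ℂ) = (A * B).trace := by
  refine Complex.conj_eq_iff_re.1 ((trace_conjTranspose (A * B)).symm.trans ?_)
  rw [conjTranspose_mul, hA.eq, hB.eq]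
  exact trace_mul_comm B A

theorem isState_iff {A : Matrix n n ℂ} : IsState A ↔ A.PosSemidef ∧ reTrace A = 1 :=
  and_congr_right fun hA => by rw [← ofReal_reTrace hA.1, Complex.ofReal_eq_one]

theorem isHermitian_and_reTrace_deriv_eq_zero {σ : ℝ → Matrix n n ℂ} {X : Matrix n n ℂ}
    (hσ : HasDerivWithinAt σ X (Set.Ici 0) 0) (hσs : ∀ᶠ s in 𝓝[≥] (0 : ℝ), IsState (σ s)) :
    X.IsHermitian ∧ reTrace X = 0 := by
  classical
  have huniq : UniqueDiffWithinAt ℝ (Set.Ici (0 : ℝ)) 0 := uniqueDiffOn_Ici 0 0 Set.self_mem_Ici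
  exact ⟨isSelfAdjoint_deriv huniq Set.self_mem_Ici hσ (hσs.mono fun _ hs => hs.1.1),
    apply_deriv_eq_zero_of_eventually_eq_const reTrace huniq Set.self_mem_Ici hσ
      (hσs.mono fun _ hs => (isState_iff.1 hs).2)⟩

variable [DecidableEq n]

theorem isFaithfulTrace_reTrace : IsFaithfulTrace (reTrace : Matrix n n ℂ →L[ℝ] ℝ) where
  mul_comm A B := by simp [trace_mul_comm A B]
  star_mul_self_pos A hA := by
    have h : 0 < (Aᴴ * A).trace := (posSemidef_conjTranspose_mul_self A).trace_nonneg.lt_of_ne'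
      (trace_conjTranspose_mul_self_eq_zero_iff.not.2 hA)
    exact (Complex.lt_def.1 h).1

theorem posSemidef_exp {H : Matrix n n ℂ} (hH : H.IsHermitian) : (exp H).PosSemidef :=
  nonneg_iff_posSemidef.1 (IsSelfAdjoint.exp_nonneg hH)

theorem eventually_isState_exp_add_smul {H X : Matrix n n ℂ} (hH : H.IsHermitian)
    (htr : reTrace (exp H) = 1) (hX : X.IsHermitian) (hX0 : reTrace X = 0) :
    ∀ᶠ s in 𝓝 (0 : ℝ), IsState (exp H + s • X) := by
  have hpos : IsStrictlyPositive (exp H) :=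
    (isUnit_exp H).isStrictlyPositive (IsSelfAdjoint.exp_nonneg hH)
  filter_upwards [eventually_nonneg_add_smul hpos hX] with s hs
  refine isState_iff.2 ⟨nonneg_iff_posSemidef.1 hs, ?_⟩
  rw [map_add, map_smul, htr, hX0, smul_zero, add_zero]

variable {a : Fin N → Matrix n n ℂ} {H A B X : Matrix n n ℂ}

theorem momentMap_reTrace_eq_iff (ha : IsCAR a) (hA : A.IsHermitian) (hB : B.IsHermitian) :
    momentMap reTrace (quadSpace a) A = momentMap reTrace (quadSpace a) B ↔
      ∀ Z ∈ quadSpan a, (Z * A).trace = (Z * B).trace := by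
  refine ⟨fun h => ?_, fun h => momentMap_eq_iff.2 fun Z hZ =>
    congrArg Complex.re (h Z (quadSpace_le_quadSpan hZ))⟩
  have hquad (Z) (hZ : Z ∈ quadSpace a) : (Z * A).trace = (Z * B).trace := by
    have hZ' := isSelfAdjoint_of_mem_quadSpace Z hZ
    rw [← ofReal_reTrace_mul hZ' hA, ← ofReal_reTrace_mul hZ' hB, momentMap_eq_iff.1 h Z hZ]
  have htr : A.trace = B.trace := by simpa using hquad 1 one_mem_quadSpace
  refine forall_mem_quadSpan_trace_mul_eq_iff.2 ⟨htr, fun k l => ?_⟩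
  have hskew : (single k l (1 : ℝ) - single l k 1)ᵀ = -(single k l 1 - single l k 1) := by simp
  simp only [majorana_mul_majorana_eq ha, add_mul, smul_mul_assoc, one_mul, trace_add, trace_smul,
    htr, hquad _ (quadraticForm_mem_quadSpace hskew)]

theorem gaussianStates_eq_expFamily : gaussianStates a = expFamily reTrace (quadSpace a) := by
  ext ρ
  constructor
  · rintro ⟨hρ, κ, K, hK, rfl⟩
    have htr : κ * reTrace (exp (quadraticForm a K)) = 1 := by
      simpa using (isState_iff.1 hρ).2
    have : Nontrivial (Matrix n n ℂ) :=
      ⟨exp (quadraticForm a K), 0, fun h => by simp [h] at htr⟩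
    rw [Complex.coe_smul, eq_inv_of_mul_eq_one_left htr]
    exact inv_smul_exp_mem_expFamily isFaithfulTrace_reTrace isSelfAdjoint_of_mem_quadSpace
      one_mem_quadSpace (quadraticForm_mem_quadSpace hK)
  · rintro ⟨⟨Y, hY, rfl⟩, htr⟩
    refine ⟨isState_iff.2 ⟨posSemidef_exp (isSelfAdjoint_of_mem_quadSpace Y hY), htr⟩, ?_⟩
    obtain ⟨K, hK, r, rfl⟩ := hY
    exact ⟨Real.exp r, K, hK, by rw [exp_add_smul_one, Complex.coe_smul]⟩

theorem tangentSpace_gaussianStates (hH : H ∈ quadSpace a) (htr : reTrace (exp H) = 1) :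
    tangentSpace (gaussianStates a) (exp H) = expTangentSpace reTrace (quadSpace a) H := by
  rw [tangentSpace, gaussianStates_eq_expFamily,
    ← Submodule.span_eq (expTangentSpace reTrace (quadSpace a) H)]
  congr 1
  ext A
  exact (mem_expTangentSpace_iff_exists_curve isFaithfulTrace_reTrace
    isSelfAdjoint_of_mem_quadSpace one_mem_quadSpace hH htr).symm

theorem isGaussification_iff (ha : IsCAR a) {σ ρ : Matrix n n ℂ} :
    IsGaussification a σ ρ ↔ IsState σ ∧ ρ ∈ expFamily reTrace (quadSpace a) ∧
      momentMap reTrace (quadSpace a) ρ = momentMap reTrace (quadSpace a) σ := by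
  rw [← gaussianStates_eq_expFamily]
  refine and_congr_right fun hσ => and_congr_right fun hρ => ?_
  have htr : ρ.trace = σ.trace := hρ.1.2.trans hσ.2.symm
  rw [covariance_eq_iff ha htr, momentMap_reTrace_eq_iff ha hρ.1.1.1 hσ.1.1,
    forall_mem_quadSpan_trace_mul_eq_iff, and_iff_right htr]

theorem isGaussifiedVelocity_of_momentMap_eq (ha : IsCAR a) (hH : H ∈ quadSpace a)
    (hA : A ∈ expTangentSpace reTrace (quadSpace a) H)
    (hAX : momentMap reTrace (quadSpace a) A = momentMap reTrace (quadSpace a) X)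
    {σ : ℝ → Matrix n n ℂ} (hσ : HasDerivWithinAt σ X (Set.Ici 0) 0) (hσ0 : σ 0 = exp H)
    (hσs : ∀ᶠ s in 𝓝[≥] (0 : ℝ), IsState (σ s)) : IsGaussifiedVelocity a σ A := by
  refine ⟨?_, fun γ hγ => ?_⟩
  · filter_upwards [hσs, eventually_existsUnique_mem_expFamily isFaithfulTrace_reTrace
      isSelfAdjoint_of_mem_quadSpace one_mem_quadSpace hH hA hAX hσ hσ0
      (hσs.mono fun s hs => (isState_iff.1 hs).2)] with s hs hex
    simpa only [isGaussification_iff ha, hs, true_and] using hex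
  · exact hasDerivWithinAt_of_momentMap_eq isFaithfulTrace_reTrace isSelfAdjoint_of_mem_quadSpace
      one_mem_quadSpace hH hA hAX hσ hσ0 Set.self_mem_Ici
      (hγ.mono fun s hs => ((isGaussification_iff ha).1 hs).2)

theorem isGaussifiedVelocity_exp_add_smul (ha : IsCAR a) (hH : H ∈ quadSpace a)
    (htr : reTrace (exp H) = 1) (hA : A ∈ expTangentSpace reTrace (quadSpace a) H)
    (hAX : momentMap reTrace (quadSpace a) A = momentMap reTrace (quadSpace a) X)
    (hX : X.IsHermitian) (hX0 : reTrace X = 0) :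
    IsGaussifiedVelocity a (fun s => exp H + s • X) A := by
  have hline : HasDerivWithinAt (fun s : ℝ => exp H + s • X) X (Set.Ici 0) 0 := by
    simpa using (((hasDerivAt_id (0 : ℝ)).smul_const X).const_add (exp H)).hasDerivWithinAt
  exact isGaussifiedVelocity_of_momentMap_eq ha hH hA hAX hline (by simp)
    ((eventually_isState_exp_add_smul (isSelfAdjoint_of_mem_quadSpace H hH) htr hX
      hX0).filter_mono nhdsWithin_le_nhds)

theorem forall_trace_majorana_mul_eq_iff (ha : IsCAR a) (hH : H ∈ quadSpace a)
    (hA : A ∈ expTangentSpace reTrace (quadSpace a) H)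
    (hB : B ∈ expTangentSpace reTrace (quadSpace a) H) :
    (∀ k l, (majorana a k * majorana a l * A).trace = (majorana a k * majorana a l * B).trace) ↔
      A = B := by
  refine ⟨fun h => ?_, fun h _ _ => by rw [h]⟩
  have hherm := isSelfAdjoint_of_mem_expTangentSpace (τ := reTrace)
    (isSelfAdjoint_of_mem_quadSpace (a := a)) hH
  have htr : A.trace = B.trace := by
    rw [← ofReal_reTrace (hherm A hA), ← ofReal_reTrace (hherm B hB)]
    exact congrArg _ (hA.2.trans hB.2.symm)
  exact injOn_momentMap_expTangentSpace isFaithfulTrace_reTrace isSelfAdjoint_of_mem_quadSpace hH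
    hA hB ((momentMap_reTrace_eq_iff ha (hherm A hA) (hherm B hB)).2
      (forall_mem_quadSpan_trace_mul_eq_iff.2 ⟨htr, h⟩))

theorem forall_trace_majorana_mul_eq_sum_iff {ι : Type*} [Fintype ι] (ha : IsCAR a)
    (hH : H ∈ quadSpace a) (hA : A ∈ expTangentSpace reTrace (quadSpace a) H)
    (hX : X.IsHermitian)
    (hAX : momentMap reTrace (quadSpace a) A = momentMap reTrace (quadSpace a) X)
    {Y : ι → Matrix n n ℂ} (hY : ∀ j, Y j ∈ expTangentSpace reTrace (quadSpace a) H)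
    (w : ι → ℝ) :
    (∀ k l, (majorana a k * majorana a l * X).trace =
      ∑ j, (w j : ℂ) * (majorana a k * majorana a l * Y j).trace) ↔ A = ∑ j, w j • Y j := by
  have hAherm : A.IsHermitian :=
    isSelfAdjoint_of_mem_expTangentSpace isSelfAdjoint_of_mem_quadSpace hH A hA
  have hmoments := (forall_mem_quadSpan_trace_mul_eq_iff.1
    ((momentMap_reTrace_eq_iff ha hAherm hX).1 hAX)).2
  have hsum (Z : Matrix n n ℂ) :
      ∑ j, (w j : ℂ) * (Z * Y j).trace = (Z * ∑ j, w j • Y j).trace := by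
    simp [Finset.mul_sum, trace_sum]
  simp only [← hmoments, hsum]
  exact forall_trace_majorana_mul_eq_iff ha hH hA
    (Submodule.sum_mem _ fun j _ => Submodule.smul_mem _ _ (hY j))

theorem exists_mem_expTangentSpace_momentMap_reTrace_eq (hH : H ∈ quadSpace a)
    (hX : reTrace X = 0) : ∃ A ∈ expTangentSpace reTrace (quadSpace a) H,
      momentMap reTrace (quadSpace a) A = momentMap reTrace (quadSpace a) X :=
  exists_mem_expTangentSpace_momentMap_eq isFaithfulTrace_reTrace isSelfAdjoint_of_mem_quadSpace
    one_mem_quadSpace hH hX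

end GaussianStates

section Metrics

open Matrix NormedSpace
open scoped Matrix.Norms.L2Operator

variable {n : Type*}

theorem convex_mapsTo_submodule (T S : Submodule ℝ (Matrix n n ℂ)) :
    Convex ℝ {Ω : Matrix n n ℂ →ₗ[ℂ] Matrix n n ℂ | ∀ B ∈ T, Ω B ∈ S} :=
  fun _ hΩ _ hΩ' r s _ _ _ B hB =>
    S.add_mem (S.smul_mem r (hΩ B hB)) (S.smul_mem s (hΩ' B hB))

variable [Fintype n]

/-- Superoperators that are symmetric and positive definite for the Hilbert-Schmidt inner
product, so that `sqLength Ω` is the square of a Hilbert norm. -/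
structure IsMetric (Ω : Matrix n n ℂ →ₗ[ℂ] Matrix n n ℂ) : Prop where
  symm : ∀ A B, (Aᴴ * Ω B).trace = ((Ω A)ᴴ * B).trace
  pos : ∀ A, A ≠ 0 → 0 < sqLength Ω A

theorem convex_isMetric : Convex ℝ {Ω : Matrix n n ℂ →ₗ[ℂ] Matrix n n ℂ | IsMetric Ω} := by
  refine convex_iff_forall_pos.2 fun Ω hΩ Ω' hΩ' r s hr hs _ => ⟨fun A B => ?_, fun A hA => ?_⟩
  · simp [mul_add, add_mul, hΩ.symm, hΩ'.symm]
  · have hsum : sqLength (r • Ω + s • Ω') A = r * sqLength Ω A + s * sqLength Ω' A := by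
      simp [sqLength, mul_add]
    rw [hsum]
    exact add_pos (mul_pos hr (hΩ.pos A hA)) (mul_pos hs (hΩ'.pos A hA))

namespace IsMetric

variable {Ω : Matrix n n ℂ →ₗ[ℂ] Matrix n n ℂ}

theorem sqLength_nonneg (hΩ : IsMetric Ω) (A : Matrix n n ℂ) : 0 ≤ sqLength Ω A := by
  rcases eq_or_ne A 0 with rfl | hA
  · simp [sqLength]
  · exact (hΩ.pos A hA).le

theorem sqLength_add (hΩ : IsMetric Ω) (C D : Matrix n n ℂ) :
    sqLength Ω (C + D) = sqLength Ω C + 2 * (Dᴴ * Ω C).trace.re + sqLength Ω D := by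
  have hcross : (Cᴴ * Ω D).trace.re = (Dᴴ * Ω C).trace.re := by
    rw [hΩ.symm, ← Complex.conj_re, starRingEnd_apply, ← trace_conjTranspose, conjTranspose_mul,
      conjTranspose_conjTranspose]
  simp only [sqLength, map_add, conjTranspose_add, add_mul, mul_add, trace_add, Complex.add_re,
    hcross]
  ring

theorem isTDVPProjection_iff (hΩ : IsMetric Ω) {T : Submodule ℝ (Matrix n n ℂ)}
    {X A : Matrix n n ℂ} (hA : A ∈ T) (horth : ∀ C ∈ T, ((A - X)ᴴ * Ω C).trace.re = 0)
    {B : Matrix n n ℂ} : IsTDVPProjection Ω T X B ↔ B = A := by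
  have hpythagoras (B) (hB : B ∈ T) :
      sqLength Ω (B - X) = sqLength Ω (B - A) + sqLength Ω (A - X) := by
    rw [← sub_add_sub_cancel B A X, hΩ.sqLength_add, horth _ (T.sub_mem hB hA), mul_zero,
      add_zero]
  constructor
  · rintro ⟨hB, hmin⟩
    by_contra hne
    have hlt := hΩ.pos (B - A) (sub_ne_zero.2 hne)
    linarith [hmin A hA, hpythagoras B hB]
  · rintro rfl
    refine ⟨hA, fun C hC => ?_⟩
    rw [hpythagoras C hC]
    exact le_add_of_nonneg_left (hΩ.sqLength_nonneg _)

end IsMetric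

variable [DecidableEq n] {H : Matrix n n ℂ}

theorem alphaMetric_exp_apply (hH : H.IsHermitian) (α : ℝ) (B : Matrix n n ℂ) :
    alphaMetric (exp H) α B = (1 / 2 : ℝ) • (exp ((-α) • H) * B * exp ((α - 1) • H) +
      exp ((α - 1) • H) * B * exp ((-α) • H)) := by
  have hpow (t : ℝ) : matPow (exp H) t = exp (t • H) := cfc_rpow_exp hH t
  rw [← Complex.coe_smul]
  simp [alphaMetric, hpow]

theorem isMetric_alphaMetric (hH : H.IsHermitian) (α : ℝ) : IsMetric (alphaMetric (exp H) α) := by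
  have hexp (t : ℝ) : (exp (t • H))ᴴ = exp (t • H) :=
    (IsHermitian.exp ((IsSelfAdjoint.all t).smul hH)).eq
  refine ⟨fun A B => ?_, fun A hA => ?_⟩
  · have hcycle (P Q : Matrix n n ℂ) : (Aᴴ * (P * B * Q)).trace = (Q * (Aᴴ * P) * B).trace := by
      rw [← mul_assoc, trace_mul_comm]
      simp only [mul_assoc]
    simp only [alphaMetric_exp_apply hH, conjTranspose_smul, conjTranspose_add, conjTranspose_mul,
      hexp, mul_smul_comm, smul_mul_assoc, mul_add, add_mul, trace_smul, trace_add, hcycle,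
      star_trivial]
  · have hpos := isFaithfulTrace_reTrace.star_mul_exp_mul_mul_exp_pos hH hA
    have hsum : sqLength (alphaMetric (exp H) α) A = (1 / 2 : ℝ) *
        (reTrace (Aᴴ * (exp ((-α) • H) * A * exp ((α - 1) • H))) +
          reTrace (Aᴴ * (exp ((α - 1) • H) * A * exp ((-α) • H)))) := by
      rw [← map_add, ← mul_add, ← smul_eq_mul, ← map_smul, ← mul_smul_comm,
        ← alphaMetric_exp_apply hH]
      rfl
    rw [hsum]
    exact mul_pos one_half_pos (add_pos (hpos _ _) (hpos _ _))

theorem isMetric_of_mem_alphaMetrics (hH : H.IsHermitian)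
    {Ω : Matrix n n ℂ →ₗ[ℂ] Matrix n n ℂ} (hΩ : Ω ∈ alphaMetrics (exp H)) : IsMetric Ω :=
  convexHull_min (Set.range_subset_iff.2 (isMetric_alphaMetric hH)) convex_isMetric hΩ

variable {N : ℕ} {a : Fin N → Matrix n n ℂ} {Ω : Matrix n n ℂ →ₗ[ℂ] Matrix n n ℂ}

theorem apply_mem_quadSpan_of_mem_alphaMetrics (ha : IsCAR a) (hH : H ∈ quadSpace a)
    (hΩ : Ω ∈ alphaMetrics (exp H)) :
    ∀ B ∈ expTangentSpace reTrace (quadSpace a) H, Ω B ∈ quadSpan a := by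
  let S := (quadSpan a).restrictScalars ℝ
  refine convexHull_min (Set.range_subset_iff.2 fun α => ?_) (convex_mapsTo_submodule _ S) hΩ
  rintro _ ⟨⟨Y, hY, rfl⟩, -⟩
  have hmem (s t : ℝ) (hst : s + t = -1) :
      exp (s • H) * fderiv ℝ exp H Y * exp (t • H) ∈ S :=
    exp_mul_fderiv_exp_mul_exp_mem (Submodule.closed_of_finiteDimensional S)
      (fun X hX => commutator_mem_quadSpan ha (quadSpace_le_quadSpan hH) hX)
      (quadSpace_le_quadSpan hY) hst
  rw [ContinuousLinearMap.coe_coe, alphaMetric_exp_apply (isSelfAdjoint_of_mem_quadSpace H hH)]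
  exact S.smul_mem _ (S.add_mem (hmem _ _ (by ring)) (hmem _ _ (by ring)))

theorem isTDVPProjection_alphaMetrics_iff (ha : IsCAR a) (hH : H ∈ quadSpace a)
    (hΩ : Ω ∈ alphaMetrics (exp H)) {A X : Matrix n n ℂ} (hX : X.IsHermitian)
    (hA : A ∈ expTangentSpace reTrace (quadSpace a) H)
    (hAX : momentMap reTrace (quadSpace a) A = momentMap reTrace (quadSpace a) X)
    {B : Matrix n n ℂ} :
    IsTDVPProjection Ω (expTangentSpace reTrace (quadSpace a) H) X B ↔ B = A := by
  have hHherm := isSelfAdjoint_of_mem_quadSpace H hH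
  have hAherm : A.IsHermitian :=
    isSelfAdjoint_of_mem_expTangentSpace isSelfAdjoint_of_mem_quadSpace hH A hA
  refine (isMetric_of_mem_alphaMetrics hHherm hΩ).isTDVPProjection_iff hA fun C hC => ?_
  have hmem := apply_mem_quadSpan_of_mem_alphaMetrics ha hH hΩ C hC
  rw [(hAherm.sub hX).eq, trace_mul_comm, mul_sub, trace_sub,
    (momentMap_reTrace_eq_iff ha hAherm hX).1 hAX _ hmem, sub_self, Complex.zero_re]

end Metrics

section Evolution

variable {n : Type*} [Fintype n]

theorem IsCPT.isState {Φ : Matrix n n ℂ →ₗ[ℂ] Matrix n n ℂ} (hΦ : IsCPT Φ) {ρ : Matrix n n ℂ}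
    (hρ : IsState ρ) : IsState (Φ ρ) :=
  ⟨(hΦ.1 1 (ρ.submatrix Prod.snd Prod.snd) (hρ.1.submatrix _)).submatrix
    fun i : n => ((0 : Fin 1), i), (hΦ.2 ρ).trans hρ.2⟩

namespace IsMarkovianEvolution

variable {E : ℝ → (Matrix n n ℂ →ₗ[ℂ] Matrix n n ℂ)} {L : Matrix n n ℂ →ₗ[ℂ] Matrix n n ℂ}

theorem apply_zero (hE : IsMarkovianEvolution E L) (ρ : Matrix n n ℂ) : E 0 ρ = ρ :=
  LinearMap.congr_fun hE.zero ρ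

theorem hasDerivWithinAt_zero (hE : IsMarkovianEvolution E L) (ρ : Matrix n n ℂ) :
    HasDerivWithinAt (fun s => E s ρ) (L ρ) (Set.Ici 0) 0 := by
  simpa only [hE.apply_zero] using hE.deriv ρ 0 le_rfl

theorem eventually_isState (hE : IsMarkovianEvolution E L) {ρ : Matrix n n ℂ} (hρ : IsState ρ) :
    ∀ᶠ s in 𝓝[≥] (0 : ℝ), IsState (E s ρ) :=
  eventually_mem_nhdsWithin.mono fun s hs => (hE.cpt s hs).isState hρ

end IsMarkovianEvolution

end Evolution

end FermionTDVP

open FermionTDVP in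
theorem theorem1_general {N : ℕ} {n : Type*} [Fintype n] [DecidableEq n]
    (a : Fin N → Matrix n n ℂ) (ha : IsCAR a)
    (ρ : Matrix n n ℂ) (hρ : ρ ∈ gaussianStates a)
    (σ : ℝ → Matrix n n ℂ) (hσ0 : σ 0 = ρ) (hσs : ∀ᶠ s in 𝓝[≥] (0 : ℝ), IsState (σ s))
    (X : Matrix n n ℂ) (hσ : HasDerivWithinAt σ X (Set.Ici 0) 0) :
    ∃ A ∈ tangentSpace (gaussianStates a) ρ,
      (∀ Ω ∈ alphaMetrics ρ, ∀ B : Matrix n n ℂ,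
        IsTDVPProjection Ω (tangentSpace (gaussianStates a) ρ) X B ↔ B = A) ∧
      (∀ (D : ℕ) (b : Module.Basis (Fin D) ℝ (tangentSpace (gaussianStates a) ρ)),
        ∃ v : Fin D → ℝ, A = ∑ j, v j • (b j : Matrix n n ℂ) ∧
          ∀ w : Fin D → ℝ,
            (∀ k₁ k₂ : Fin N × Fin 2,
              (majorana a k₁ * majorana a k₂ * X).trace =
                ∑ j, (w j : ℂ) *
                  (majorana a k₁ * majorana a k₂ * (b j : Matrix n n ℂ)).trace) ↔ w = v) ∧
      IsGaussifiedVelocity a σ A ∧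
      IsGaussifiedVelocity a (fun s => ρ + s • X) A := by
  obtain ⟨⟨H, hH, rfl⟩, htr⟩ := gaussianStates_eq_expFamily.subset hρ
  obtain ⟨hX, hX0⟩ := isHermitian_and_reTrace_deriv_eq_zero hσ hσs
  obtain ⟨A, hA, hAX⟩ := exists_mem_expTangentSpace_momentMap_reTrace_eq hH hX0
  rw [tangentSpace_gaussianStates hH htr]
  refine ⟨A, hA, fun Ω hΩ B => isTDVPProjection_alphaMetrics_iff ha hH hΩ hX hA hAX,
    fun D b => ⟨b.repr ⟨A, hA⟩, (eq_sum_smul_basis_iff b hA _).2 rfl, fun w =>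
      (forall_trace_majorana_mul_eq_sum_iff ha hH hA hX hAX (fun j => (b j).2) w).trans
        (eq_sum_smul_basis_iff b hA w)⟩,
    isGaussifiedVelocity_of_momentMap_eq ha hH hA hAX hσ hσ0 hσs,
    isGaussifiedVelocity_exp_add_smul ha hH htr hA hAX hX hX0⟩

open FermionTDVP in
theorem theorem1 {N : ℕ} {n : Type*} [Fintype n] [DecidableEq n]
    (a : Fin N → Matrix n n ℂ) (ha : IsCAR a)
    (E : ℝ → (Matrix n n ℂ →ₗ[ℂ] Matrix n n ℂ)) (L : Matrix n n ℂ →ₗ[ℂ] Matrix n n ℂ)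
    (hE : IsMarkovianEvolution E L)
    (ρ : Matrix n n ℂ) (hρ : ρ ∈ gaussianStates a) :
    ∃ A ∈ tangentSpace (gaussianStates a) ρ,
      -- for every metric, `A` is the one and only TDVP projection of `L ρ`
      (∀ Ω ∈ alphaMetrics ρ, ∀ B : Matrix n n ℂ,
        IsTDVPProjection Ω (tangentSpace (gaussianStates a) ρ) (L ρ) B ↔ B = A) ∧
      -- in every basis of the tangent space, the coordinates of `A` are the unique solution of
      -- the Gaussification equations
      (∀ (D : ℕ) (b : Module.Basis (Fin D) ℝ (tangentSpace (gaussianStates a) ρ)),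
        ∃ v : Fin D → ℝ, A = ∑ j, v j • (b j : Matrix n n ℂ) ∧
          ∀ w : Fin D → ℝ,
            (∀ k₁ k₂ : Fin N × Fin 2,
              (majorana a k₁ * majorana a k₂ * L ρ).trace =
                ∑ j, (w j : ℂ) *
                  (majorana a k₁ * majorana a k₂ * (b j : Matrix n n ℂ)).trace) ↔ w = v) ∧
      -- `A` is the velocity of the Gaussified evolution, and of the Gaussified linear step
      IsGaussifiedVelocity a (fun s => E s ρ) A ∧
      IsGaussifiedVelocity a (fun s => ρ + s • L ρ) A :=
  theorem1_general a ha ρ hρ (fun s => E s ρ) (hE.apply_zero ρ) (hE.eventually_isState hρ.1)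
    (L ρ) (hE.hasDerivWithinAt_zero ρ)
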